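/- Let $R$ be an associative ring with unity and let $n \ge 0$ be an integer. Assume that $R$ is right coherent (every finitely generated right ideal of $R$ is finitely presented) and left $n$-perfect (every flat left $R$-module has projective dimension at most $n$). Then every Gorenstein flat left $R$-module $M$ has Gorenstein projective dimension at most $n$, i.e. there is an exact sequence $0 \to G_n \to \cdots \to G_1 \to G_0 \to M \to 0$ of left $R$-modules in which every $G_i$ is Gorenstein projective. Here a left $R$-module $M$ is Gorenstein flat if $M \cong \operatorname{Ker}(F_0 \to F_{-1})$ for some exact sequence $\cdots \to F_1 \to F_0 \to F_{-1} \to \cdots$ of flat left $R$-modules that remains exact after applying $E \otimes_R -$ for every injective right $R$-module $E$; and it is Gorenstein projective if $M \cong \operatorname{Ker}(P_0 \to P_{-1})$ for some exact sequence $\cdots \to P_1 \to P_0 \to P_{-1} \to \cdots$ of projective left $R$-modules that remains exact after applying $\operatorname{Hom}_R(-,Q)$ for every projective left $R$-module $Q$. -/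

import Mathlib

universe u

open CategoryTheory

namespace GorensteinModules

noncomputable section

/-! A right `R`-module is a module over `Rᵐᵒᵖ`: the product `e · r` is `MulOpposite.op r • e`. -/

/-- The relations `(e · r) ⊗ m = e ⊗ (r • m)` that have to be imposed on `E ⊗_ℤ M` in order to
obtain the tensor product over `R`. -/
def balancedRel (R : Type u) [Ring R] (E : Type u) [AddCommGroup E] [Module Rᵐᵒᵖ E]
    (M : Type u) [AddCommGroup M] [Module R M] : Submodule ℤ (TensorProduct ℤ E M) :=
  Submodule.span ℤ {t | ∃ (e : E) (r : R) (m : M),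
    t = TensorProduct.tmul ℤ (MulOpposite.op r • e) m - TensorProduct.tmul ℤ e (r • m)}

/-- The tensor product `E ⊗_R M` of a right module `E` and a left module `M` over a ring `R` that
need not be commutative; it is an abelian group. -/
abbrev BalancedTensor (R : Type u) [Ring R] (E : Type u) [AddCommGroup E] [Module Rᵐᵒᵖ E]
    (M : Type u) [AddCommGroup M] [Module R M] : Type u :=
  TensorProduct ℤ E M ⧸ balancedRel R E M

theorem balancedRel_le_comap (R : Type u) [Ring R]
    {E E' : Type u} [AddCommGroup E] [Module Rᵐᵒᵖ E] [AddCommGroup E'] [Module Rᵐᵒᵖ E']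
    {M M' : Type u} [AddCommGroup M] [Module R M] [AddCommGroup M'] [Module R M']
    (f : E →ₗ[Rᵐᵒᵖ] E') (g : M →ₗ[R] M') :
    balancedRel R E M ≤ (balancedRel R E' M').comap
      (TensorProduct.map f.toAddMonoidHom.toIntLinearMap g.toAddMonoidHom.toIntLinearMap) := by
  refine Submodule.span_le.2 ?_
  rintro _ ⟨e, r, m, rfl⟩
  refine Submodule.subset_span ⟨f e, r, g m, ?_⟩
  simp

/-- The homomorphism `f ⊗ g : E ⊗_R M → E' ⊗_R M'`. -/
def balancedMap (R : Type u) [Ring R]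
    {E E' : Type u} [AddCommGroup E] [Module Rᵐᵒᵖ E] [AddCommGroup E'] [Module Rᵐᵒᵖ E']
    {M M' : Type u} [AddCommGroup M] [Module R M] [AddCommGroup M'] [Module R M']
    (f : E →ₗ[Rᵐᵒᵖ] E') (g : M →ₗ[R] M') : BalancedTensor R E M →ₗ[ℤ] BalancedTensor R E' M' :=
  (balancedRel R E M).mapQ (balancedRel R E' M')
    (TensorProduct.map f.toAddMonoidHom.toIntLinearMap g.toAddMonoidHom.toIntLinearMap)
    (balancedRel_le_comap R f g)

/-- A left `R`-module `M` is flat if `- ⊗_R M` preserves injectivity of homomorphisms of right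
`R`-modules. -/
def IsFlat (R : Type u) [Ring R] (M : Type u) [AddCommGroup M] [Module R M] : Prop :=
  ∀ (A B : Type u) [AddCommGroup A] [AddCommGroup B] [Module Rᵐᵒᵖ A] [Module Rᵐᵒᵖ B]
    (f : A →ₗ[Rᵐᵒᵖ] B), Function.Injective f →
      Function.Injective (balancedMap R f (LinearMap.id : M →ₗ[R] M))

/-- A ring `R` is right coherent if every finitely generated right ideal of `R` is finitely
presented as a right `R`-module. -/
def IsRightCoherent (R : Type u) [Ring R] : Prop :=
  ∀ I : Submodule Rᵐᵒᵖ R, I.FG → Module.FinitePresentation Rᵐᵒᵖ I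

/-- A ring `R` is left `n`-perfect if every flat left `R`-module has projective dimension at
most `n`. -/
def IsLeftPerfect (R : Type u) [Ring R] (n : ℕ) : Prop :=
  ∀ F : ModuleCat.{u} R, IsFlat R F → HasProjectiveDimensionLE F n

/-- A complex `P` of left `R`-modules is `Hom(-, Proj)` exact if the complex `Hom_R(P, Q)` is exact
for every projective left `R`-module `Q`. -/
def IsHomProjExact {R : Type u} [Ring R] (P : ChainComplex (ModuleCat.{u} R) ℤ) : Prop :=
  ∀ Q : ModuleCat.{u} R, Module.Projective R Q → ∀ i : ℤ,
    Function.Exact (fun f : P.X (i - 1) ⟶ Q => P.d i (i - 1) ≫ f)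
      (fun f : P.X i ⟶ Q => P.d (i + 1) i ≫ f)

/-- A complex `F` of left `R`-modules is `Inj ⊗ -` exact if the complex `E ⊗_R F` is exact for
every injective right `R`-module `E`. -/
def IsInjTensorExact {R : Type u} [Ring R] (F : ChainComplex (ModuleCat.{u} R) ℤ) : Prop :=
  ∀ (E : Type u) [AddCommGroup E] [Module Rᵐᵒᵖ E], Module.Injective Rᵐᵒᵖ E → ∀ i : ℤ,
    Function.Exact (balancedMap R (LinearMap.id : E →ₗ[Rᵐᵒᵖ] E) (F.d (i + 1) i).hom)
      (balancedMap R (LinearMap.id : E →ₗ[Rᵐᵒᵖ] E) (F.d i (i - 1)).hom)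

/-- A left `R`-module `M` is Gorenstein projective if `M ≅ Ker (P₀ → P₋₁)` for an exact and
`Hom(-, Proj)` exact complex `P` of projective modules. -/
def IsGorensteinProjective {R : Type u} [Ring R] (M : ModuleCat.{u} R) : Prop :=
  ∃ P : ChainComplex (ModuleCat.{u} R) ℤ,
    (∀ i, Module.Projective R (P.X i)) ∧ P.Acyclic ∧ IsHomProjExact P ∧
      Nonempty (M ≃ₗ[R] LinearMap.ker (P.d 0 (-1)).hom)

/-- A left `R`-module `M` is Gorenstein flat if `M ≅ Ker (F₀ → F₋₁)` for an exact and
`Inj ⊗ -` exact complex `F` of flat modules. -/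
def IsGorensteinFlat {R : Type u} [Ring R] (M : ModuleCat.{u} R) : Prop :=
  ∃ F : ChainComplex (ModuleCat.{u} R) ℤ,
    (∀ i, IsFlat R (F.X i)) ∧ F.Acyclic ∧ IsInjTensorExact F ∧
      Nonempty (M ≃ₗ[R] LinearMap.ker (F.d 0 (-1)).hom)

/-- `M` has Gorenstein projective dimension at most `n`: there is an exact sequence
`0 → Gₙ → ⋯ → G₁ → G₀ → M → 0` with all `Gᵢ` Gorenstein projective (the sequence is continued by
`Gᵢ = 0` for `i > n`). -/
def HasGorensteinProjectiveDimensionLE {R : Type u} [Ring R] (M : ModuleCat.{u} R) (n : ℕ) :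
    Prop :=
  ∃ (G : ℕ → ModuleCat.{u} R) (d : ∀ i, G (i + 1) ⟶ G i) (ε : G 0 ⟶ M),
    (∀ i, IsGorensteinProjective (G i)) ∧ (∀ i, n < i → Subsingleton (G i)) ∧
      Function.Surjective ε ∧ Function.Exact (d 0) ε ∧
      ∀ i, Function.Exact (d (i + 1)) (d i)

end

end GorensteinModules

/-! Write `A⁺` for the character module. As `Hom(F, E⁺) ≅ (E ⊗ F)⁺`, the tensor condition on a flat
complex says that `Hom(F, E⁺)` is exact for injective `E`. Cover such a complex by a contractible
complex of free modules. The kernel inherits flat terms, exactness and this Hom-exactness, while the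
bound on the projective dimensions of its terms drops by one, and its cycles are first syzygies of
the old cycles. By `n`-perfectness, `n` such steps lead to projective terms, so it remains to show
that the last cycles are Gorenstein projective.

For this, a flat `Q` embeds purely in `Q⁺⁺`. Here `Q⁺` is injective, so Hom into `Q⁺⁺` is exact, and
coherence makes `Q⁺⁺/Q` flat. Since `Ext^{n+1}(F, Q) = 0` for flat `F` and `Ext^i(F, E⁺) = 0` for `i
> 0`, dimension shifting ends at a split sequence. This gives exactness of Hom into every flat `Q`
(`homExact_of_ext_eq_zero`), in particular every projective one. -/

namespace GorensteinModules

noncomputable section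

/-! ### Characters, factorizations and splittings -/

section General

variable {S : Type*} [Ring S]

/-- `ℚ/ℤ` is divisible, hence injective, so the character induced on `A / ker f` extends along `A /
ker f ↪ C`. -/
theorem exists_character_comp_eq {A C : Type*} [AddCommGroup A] [AddCommGroup C]
    (f : A →+ C) (g : A →+ AddCircle (1 : ℚ)) (h : ∀ a, f a = 0 → g a = 0) :
    ∃ k : C →+ AddCircle (1 : ℚ), ∀ a, k (f a) = g a := by
  obtain ⟨k, hk⟩ := (Module.Baer.of_divisible (AddCircle (1 : ℚ))).extension_property_addMonoidHom
    (QuotientAddGroup.kerLift f) (QuotientAddGroup.kerLift_injective f)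
    (QuotientAddGroup.lift f.ker g h)
  exact ⟨k, fun a => DFunLike.congr_fun hk (QuotientAddGroup.mk a)⟩

theorem character_ext {A : Type*} [AddCommGroup A] {φ ψ : CharacterModule A}
    (h : ∀ x, φ x = ψ x) : φ = ψ := DFunLike.ext _ _ h

theorem exists_comp_eq_of_surjective {X Y Z : Type*} [AddCommGroup X] [AddCommGroup Y]
    [AddCommGroup Z] [Module S X] [Module S Y] [Module S Z] {p : X →ₗ[S] Y}
    (hp : Function.Surjective p) (f : X →ₗ[S] Z) (h : ∀ x, p x = 0 → f x = 0) :
    ∃ g : Y →ₗ[S] Z, ∀ x, g (p x) = f x := by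
  refine ⟨(LinearMap.ker p).liftQ f h ∘ₗ (p.quotKerEquivOfSurjective hp).symm.toLinearMap,
    fun x => ?_⟩
  have : (p.quotKerEquivOfSurjective hp).symm (p x) = (LinearMap.ker p).mkQ x := by
    rw [LinearEquiv.symm_apply_eq]; rfl
  rw [LinearMap.comp_apply, LinearEquiv.coe_coe, this]
  rfl

theorem injective_of_retract {X Y : Type u} [AddCommGroup X] [AddCommGroup Y]
    [Module S X] [Module S Y] (i : X →ₗ[S] Y) (r : Y →ₗ[S] X) (h : ∀ x, r (i x) = x)
    (hY : Module.Injective S Y) : Module.Injective S X where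
  out A B _ _ _ _ f hf g := by
    obtain ⟨k, hk⟩ := hY.out f hf (i ∘ₗ g)
    exact ⟨r ∘ₗ k, fun x => by simp [hk, h]⟩

theorem exists_retraction_of_section {X Y Z : Type*} [AddCommGroup X] [AddCommGroup Y]
    [AddCommGroup Z] [Module S X] [Module S Y] [Module S Z] {i : X →ₗ[S] Y} {p : Y →ₗ[S] Z}
    (hi : Function.Injective i) (h : Function.Exact i p) (s : Z →ₗ[S] Y) (hs : ∀ z, p (s z) = z) :
    ∃ r : Y →ₗ[S] X, ∀ x, r (i x) = x := by
  have t := h.split_tfae'.out 0 1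
  obtain ⟨-, r, hr⟩ := t.1 ⟨hi, s, LinearMap.ext hs⟩
  exact ⟨r, LinearMap.congr_fun hr⟩

theorem exists_section_of_retraction {X Y Z : Type*} [AddCommGroup X] [AddCommGroup Y]
    [AddCommGroup Z] [Module S X] [Module S Y] [Module S Z] {i : X →ₗ[S] Y} {p : Y →ₗ[S] Z}
    (hp : Function.Surjective p) (h : Function.Exact i p) (r : Y →ₗ[S] X)
    (hr : ∀ x, r (i x) = x) : ∃ s : Z →ₗ[S] Y, ∀ z, p (s z) = z := by
  have t := h.split_tfae'.out 1 0
  obtain ⟨-, s, hs⟩ := t.1 ⟨hp, r, LinearMap.ext hr⟩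
  exact ⟨s, LinearMap.congr_fun hs⟩

end General

/-! ### Character modules, tensor–hom duality and flatness -/

variable {R : Type u} [Ring R]

/-- The character module of a right module is a left module, by `(r • φ) e = φ (e · r)`. -/
instance characterModuleOfRight (E : Type u) [AddCommGroup E] [Module Rᵐᵒᵖ E] :
    Module R (CharacterModule E) where
  smul r φ := AddMonoidHom.comp φ (DistribSMul.toAddMonoidHom E (MulOpposite.op r))
  one_smul φ := character_ext fun x => congrArg φ (one_smul Rᵐᵒᵖ x)
  mul_smul r s φ := character_ext fun x => congrArg φ (mul_smul (MulOpposite.op s) (.op r) x)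
  smul_zero _ := rfl
  smul_add _ _ _ := rfl
  add_smul r s φ := character_ext fun x =>
    (congrArg φ (add_smul (MulOpposite.op r) (.op s) x)).trans (map_add φ _ _)
  zero_smul φ := character_ext fun x => (congrArg φ (zero_smul Rᵐᵒᵖ x)).trans (map_zero φ)

/-- The character module of a left module is a right module, by `(φ · r) m = φ (r • m)`. -/
instance characterModuleOfLeft (M : Type u) [AddCommGroup M] [Module R M] :
    Module Rᵐᵒᵖ (CharacterModule M) where
  smul r φ := AddMonoidHom.comp φ (DistribSMul.toAddMonoidHom M r.unop)
  one_smul φ := character_ext fun x => congrArg φ (one_smul R x)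
  mul_smul r s φ := character_ext fun x => congrArg φ (mul_smul s.unop r.unop x)
  smul_zero _ := rfl
  smul_add _ _ _ := rfl
  add_smul r s φ := character_ext fun x =>
    (congrArg φ (add_smul r.unop s.unop x)).trans (map_add φ _ _)
  zero_smul φ := character_ext fun x => (congrArg φ (zero_smul R x)).trans (map_zero φ)

section Dual

variable {E E' : Type u} [AddCommGroup E] [Module Rᵐᵒᵖ E] [AddCommGroup E'] [Module Rᵐᵒᵖ E']
  {M M' : Type u} [AddCommGroup M] [Module R M] [AddCommGroup M'] [Module R M']

theorem sum_character_apply {A ι : Type u} [AddCommGroup A] (s : Finset ι)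
    (φ : ι → CharacterModule A) (x : A) : (∑ i ∈ s, φ i) x = ∑ i ∈ s, φ i x :=
  AddMonoidHom.finsetSum_apply (M := A) (N := AddCircle (1 : ℚ)) φ s x

variable (R) in
/-- The bijection `Hom(M, E⁺) ≅ Hom(E, M⁺)`, from left to right. -/
def flipRight (g : M →ₗ[R] CharacterModule E) : E →ₗ[Rᵐᵒᵖ] CharacterModule M where
  toFun x := AddMonoidHom.mk' (fun m => g m x) fun m m' => DFunLike.congr_fun (map_add g m m') x
  map_add' x y := character_ext fun m => map_add (g m) x y
  map_smul' r x := character_ext fun m =>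
    (DFunLike.congr_fun (map_smul g r.unop m) x).symm

variable (R) in
/-- The bijection `Hom(M, E⁺) ≅ Hom(E, M⁺)`, from right to left. -/
def flipLeft (g : E →ₗ[Rᵐᵒᵖ] CharacterModule M) : M →ₗ[R] CharacterModule E where
  toFun m := AddMonoidHom.mk' (fun x => g x m) fun x y => DFunLike.congr_fun (map_add g x y) m
  map_add' x y := character_ext fun m => map_add (g m) x y
  map_smul' r x := character_ext fun m =>
    (DFunLike.congr_fun (map_smul g (MulOpposite.op r) m) x).symm

/-- The map `M'⁺ → M⁺` induced by `M → M'`. -/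
def dualMap (f : M →ₗ[R] M') : CharacterModule M' →ₗ[Rᵐᵒᵖ] CharacterModule M where
  toFun φ := AddMonoidHom.comp φ f.toAddMonoidHom
  map_add' _ _ := rfl
  map_smul' r φ := character_ext fun m => congrArg φ (map_smul f r.unop m).symm

theorem exists_character_extension {A B : Type*} [AddCommGroup A] [AddCommGroup B] (f : A →+ B)
    (hf : Function.Injective f) (φ : CharacterModule A) :
    ∃ ψ : CharacterModule B, ∀ a, ψ (f a) = φ a := by
  refine exists_character_comp_eq f φ fun a ha => ?_
  rw [(map_eq_zero_iff f hf).1 ha]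
  exact map_zero φ

/-- The character of `E ⊗_ℤ M` that corresponds to a homomorphism `E → M⁺`. -/
def intTensorCharacter (g : E →ₗ[Rᵐᵒᵖ] CharacterModule M) :
    TensorProduct ℤ E M →+ AddCircle (1 : ℚ) :=
  TensorProduct.liftAddHom
    (AddMonoidHom.mk' (fun x => (g x : M →+ AddCircle (1 : ℚ))) fun x y => map_add g x y)
    fun r x m => by
      change g (r • x) m = g x (r • m)
      rw [map_zsmul g, map_zsmul (g x)]; rfl

/-- The character of `E ⊗_R M` that corresponds to a homomorphism `E → M⁺`. -/
def tensorCharacter (g : E →ₗ[Rᵐᵒᵖ] CharacterModule M) :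
    BalancedTensor R E M →ₗ[ℤ] AddCircle (1 : ℚ) :=
  (balancedRel R E M).liftQ (intTensorCharacter g).toIntLinearMap (by
    refine Submodule.span_le.2 ?_
    rintro _ ⟨e, r, m, rfl⟩
    change intTensorCharacter g (TensorProduct.tmul ℤ (MulOpposite.op r • e) m -
      TensorProduct.tmul ℤ e (r • m)) = 0
    rw [map_sub, sub_eq_zero]
    change g (MulOpposite.op r • e) m = g e (r • m)
    rw [map_smul g]; rfl)

/-- The homomorphism `E → M⁺` that corresponds to a character of `E ⊗_R M`. -/
def homOfTensorCharacter (c : BalancedTensor R E M →+ AddCircle (1 : ℚ)) :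
    E →ₗ[Rᵐᵒᵖ] CharacterModule M where
  toFun x := AddMonoidHom.mk' (fun m => c (Submodule.Quotient.mk (TensorProduct.tmul ℤ x m)))
    fun m m' => by rw [TensorProduct.tmul_add, Submodule.Quotient.mk_add, map_add]
  map_add' x y := character_ext fun m => by
    change c _ = c _ + c _
    rw [TensorProduct.add_tmul, Submodule.Quotient.mk_add, map_add]
  map_smul' r x := character_ext fun m => by
    change c _ = c _
    congr 1
    exact (Submodule.Quotient.eq _).2 (Submodule.subset_span ⟨x, r.unop, m, rfl⟩)

theorem balancedTensor_hom_ext {A : Type*} [AddCommGroup A] {f g : BalancedTensor R E M →+ A}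
    (h : ∀ x m, f (Submodule.Quotient.mk (TensorProduct.tmul ℤ x m)) =
      g (Submodule.Quotient.mk (TensorProduct.tmul ℤ x m))) (t : BalancedTensor R E M) :
    f t = g t := by
  obtain ⟨t, rfl⟩ := Submodule.Quotient.mk_surjective _ t
  induction t with
  | zero => simp
  | tmul x m => exact h x m
  | add x y hx hy => rw [Submodule.Quotient.mk_add, map_add, map_add, hx, hy]

end Dual

/-- Lambek's criterion: a module is flat exactly if its character module is injective. -/
theorem isFlat_iff_injective {M : Type u} [AddCommGroup M] [Module R M] :
    IsFlat R M ↔ Module.Injective Rᵐᵒᵖ (CharacterModule M) := by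
  refine ⟨fun h => ⟨fun A B _ _ _ _ f hf g => ?_⟩, fun h A B _ _ _ _ f hf => ?_⟩
  · obtain ⟨k, hk⟩ := exists_character_extension (balancedMap R f LinearMap.id).toAddMonoidHom
      (h A B f hf) (tensorCharacter g).toAddMonoidHom
    refine ⟨homOfTensorCharacter k, fun x => character_ext fun m => ?_⟩
    exact hk (Submodule.Quotient.mk (TensorProduct.tmul ℤ x m))
  · rw [injective_iff_map_eq_zero]
    intro t ht
    by_contra hne
    obtain ⟨c, hc⟩ := CharacterModule.exists_character_apply_ne_zero_of_ne_zero hne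
    obtain ⟨k, hk⟩ := h.out f hf (homOfTensorCharacter c)
    apply hc
    have := balancedTensor_hom_ext (f := c)
      (g := ((tensorCharacter k).comp (balancedMap R f LinearMap.id)).toAddMonoidHom)
      (fun x m => (DFunLike.congr_fun (hk x) m).symm) t
    refine this.trans ?_
    change tensorCharacter k (balancedMap R f LinearMap.id t) = 0
    rw [ht, map_zero]

/-- Under `Hom(A, M⁺) ≅ Hom(M, A⁺)`, extending along `A ↪ B` becomes lifting along the surjection
`B⁺ → A⁺`. -/
theorem isFlat_of_projective {M : Type u} [AddCommGroup M] [Module R M] [Module.Projective R M] :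
    IsFlat R M := by
  refine isFlat_iff_injective.2 ⟨fun A B _ _ _ _ f hf g => ?_⟩
  let d : CharacterModule B →ₗ[R] CharacterModule A :=
    { toFun := fun φ => AddMonoidHom.comp φ f.toAddMonoidHom
      map_add' := fun _ _ => rfl
      map_smul' := fun r φ => character_ext fun x =>
        congrArg φ (map_smul f (MulOpposite.op r) x).symm }
  have hd : Function.Surjective d := fun φ => by
    obtain ⟨ψ, hψ⟩ := exists_character_extension f.toAddMonoidHom hf φ
    exact ⟨ψ, character_ext hψ⟩
  obtain ⟨k, hk⟩ := Module.projective_lifting_property d (flipLeft R g) hd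
  exact ⟨flipRight R k, fun x => character_ext fun m =>
    DFunLike.congr_fun (LinearMap.congr_fun hk m) x⟩

/-! ### Short exact sequences with flat cokernel -/

section Pure

variable {K P C : Type u} [AddCommGroup K] [AddCommGroup P] [AddCommGroup C] [Module R K]
  [Module R P] [Module R C] {j : K →ₗ[R] P} {p : P →ₗ[R] C}

theorem dualMap_exact (h : Function.Exact j p) :
    Function.Exact (dualMap p) (dualMap j) := by
  intro φ
  constructor
  · intro hφ
    obtain ⟨k, hk⟩ := exists_character_comp_eq p.toAddMonoidHom φ fun x hx => by
      obtain ⟨y, rfl⟩ := (h x).1 hx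
      exact DFunLike.congr_fun hφ y
    exact ⟨k, character_ext hk⟩
  · rintro ⟨k, rfl⟩
    refine character_ext fun x => ?_
    change k (p (j x)) = 0
    rw [h.apply_apply_eq_zero]
    exact map_zero k

theorem dualMap_injective (hp : Function.Surjective p) : Function.Injective (dualMap p) := by
  intro φ ψ h
  refine character_ext fun c => ?_
  obtain ⟨x, rfl⟩ := hp c
  exact DFunLike.congr_fun h x

theorem dualMap_surjective (hj : Function.Injective j) : Function.Surjective (dualMap j) := by
  intro φ
  obtain ⟨ψ, hψ⟩ := exists_character_extension j.toAddMonoidHom hj φ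
  exact ⟨ψ, character_ext hψ⟩

/-- The dual sequence `0 → C⁺ → P⁺ → K⁺ → 0` splits because `C⁺` is injective; this is purity of the
original sequence. -/
theorem IsFlat.exists_dualMap_section (hC : IsFlat R C) (hj : Function.Injective j)
    (hp : Function.Surjective p) (h : Function.Exact j p) :
    ∃ s : CharacterModule K →ₗ[Rᵐᵒᵖ] CharacterModule P, ∀ χ, dualMap j (s χ) = χ := by
  obtain ⟨r, hr⟩ := (isFlat_iff_injective.1 hC).out (dualMap p) (dualMap_injective hp)
    LinearMap.id
  exact exists_section_of_retraction (dualMap_surjective hj) (dualMap_exact h) r hr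

/-- Transpose `g` to `E → K⁺`, compose with the section `K⁺ → P⁺`, and transpose back. No
injectivity of `E` is needed. -/
theorem IsFlat.exists_extension (hC : IsFlat R C) (hj : Function.Injective j)
    (hp : Function.Surjective p) (h : Function.Exact j p)
    {E : Type u} [AddCommGroup E] [Module Rᵐᵒᵖ E] (g : K →ₗ[R] CharacterModule E) :
    ∃ k : P →ₗ[R] CharacterModule E, ∀ x, k (j x) = g x := by
  obtain ⟨s, hs⟩ := hC.exists_dualMap_section hj hp h
  exact ⟨flipLeft R (s ∘ₗ flipRight R g), fun x => character_ext fun e =>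
    DFunLike.congr_fun (hs (flipRight R g e)) x⟩

theorem IsFlat.of_exact (hP : IsFlat R P) (hC : IsFlat R C) (hj : Function.Injective j)
    (hp : Function.Surjective p) (h : Function.Exact j p) : IsFlat R K := by
  obtain ⟨s, hs⟩ := hC.exists_dualMap_section hj hp h
  exact isFlat_iff_injective.2
    (injective_of_retract s (dualMap j) hs (isFlat_iff_injective.1 hP))

end Pure

/-- Over a right coherent ring the character module of an injective right module is flat. -/
theorem IsRightCoherent.isFlat_characterModule (hcoh : IsRightCoherent R) (E : Type u)
    [AddCommGroup E] [Module Rᵐᵒᵖ E] (hE : Module.Injective Rᵐᵒᵖ E) :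
    IsFlat R (CharacterModule E) := by
  refine isFlat_iff_injective.2 (Module.Baer.injective fun J h => ?_)
  -- By Baer's criterion, `h : J → E⁺⁺` has to extend. Seen as a character of `J ⊗ E⁺`, it must
  -- factor through multiplication into `E⁺`, so it must vanish on the kernel of multiplication.
  have key : ∀ (ι : Type u) [Fintype ι] (a : ι → J) (φ : ι → CharacterModule E),
      ∑ i, (a i).1.unop • φ i = 0 → ∑ i, h (a i) (φ i) = 0 := by
    classical
    intro ι _ a φ hφ
    let b : ι → R := fun i => (a i).1.unop
    let I : Submodule Rᵐᵒᵖ R := Submodule.span Rᵐᵒᵖ (Set.range b)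
    have hI : Module.FinitePresentation Rᵐᵒᵖ I :=
      hcoh I (Submodule.fg_span (Set.finite_range b))
    let b' : ι → I := fun i => ⟨b i, Submodule.subset_span ⟨i, rfl⟩⟩
    let l : (ι → Rᵐᵒᵖ) →ₗ[Rᵐᵒᵖ] I := Fintype.linearCombination Rᵐᵒᵖ b'
    have hl : Function.Surjective l := by
      rintro ⟨x, hx⟩
      obtain ⟨c, hc⟩ := (Submodule.mem_span_range_iff_exists_fun Rᵐᵒᵖ).1 hx
      refine ⟨c, Subtype.ext ?_⟩
      simpa [l, Fintype.linearCombination_apply, b'] using hc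
    obtain ⟨s, hs⟩ := Module.FinitePresentation.fg_ker l hl
    let Θ : (ι → E) →+ AddCircle (1 : ℚ) :=
      ∑ i, AddMonoidHom.comp (φ i) (Pi.evalAddMonoidHom (fun _ : ι => E) i)
    have hΘ : ∀ e, Θ e = ∑ i, φ i (e i) := fun e => AddMonoidHom.finsetSum_apply _ _ _
    let f : (ι → E) →+ (s → E) := AddMonoidHom.mk' (fun e r => ∑ i, r.1 i • e i) (by
      intro e e'; ext r; simp [Finset.sum_add_distrib])
    -- The finite set `s` generates the relations among the `b i`. A tuple `e` killed by `f`
    -- satisfies them, so it defines a map `I → E`, which extends to `R` as `E` is injective. Hence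
    -- `e i = w 1 · b i`, and `Θ e` is the given relation evaluated at `w 1`.
    obtain ⟨Ψ, hΨ⟩ := exists_character_comp_eq f Θ (by
      intro e he
      obtain ⟨v, hv⟩ := exists_comp_eq_of_surjective hl (Fintype.linearCombination Rᵐᵒᵖ e) (by
        intro c hc
        have : LinearMap.ker l ≤ LinearMap.ker (Fintype.linearCombination Rᵐᵒᵖ e) := by
          rw [← hs, Submodule.span_le]
          intro r hr
          exact congrFun he ⟨r, hr⟩
        exact this hc)
      obtain ⟨w, hw⟩ := hE.out I.subtype I.injective_subtype v
      have hwe : ∀ i, e i = MulOpposite.op (b i) • w 1 := by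
        intro i
        have h1 := hv (Pi.single i 1)
        simp only [l, Fintype.linearCombination_apply_single, one_smul] at h1
        rw [← h1, ← hw, ← map_smul]
        simp [b']
      rw [hΘ]
      have := DFunLike.congr_fun hφ (w 1)
      rw [sum_character_apply] at this
      simp only [hwe]
      exact this)
    let ψ : s → CharacterModule E := fun r =>
      AddMonoidHom.comp Ψ (AddMonoidHom.single (fun _ : s => E) r)
    have hψ : ∀ i, φ i = ∑ r : s, (r.1 i).unop • ψ r := by
      intro i
      refine character_ext fun x => ?_
      have h1 := hΨ (Pi.single i x)
      rw [hΘ, Finset.sum_eq_single i (by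
        intro k _ hk
        rw [Pi.single_eq_of_ne hk]; exact map_zero (φ k)) (by simp)] at h1
      rw [Pi.single_eq_same] at h1
      rw [← h1, sum_character_apply]
      have h2 : f (Pi.single i x) = ∑ r : s, Pi.single r (r.1 i • x) := by
        ext r
        rw [Finset.sum_apply, Finset.sum_eq_single r (by
          intro k _ hk
          rw [Pi.single_eq_of_ne hk.symm]) (by simp), Pi.single_eq_same]
        change ∑ k, r.1 k • (Pi.single i x : ι → E) k = _
        rw [Finset.sum_eq_single i (by
          intro k _ hk
          rw [Pi.single_eq_of_ne hk, smul_zero]) (by simp), Pi.single_eq_same]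
      rw [h2, map_sum]
      rfl
    -- The coefficients `r i` move across to `a i`; summed over `i`, they give a relation of the `a
    -- i`, which is zero.
    have h3 : ∀ i, h (a i) (φ i) = ∑ r : s, h (r.1 i • a i) (ψ r) := by
      intro i
      rw [hψ i, map_sum]
      refine Finset.sum_congr rfl fun r _ => ?_
      rw [map_smul h]
      rfl
    simp only [h3]
    rw [Finset.sum_comm]
    refine Finset.sum_eq_zero fun r _ => ?_
    rw [← sum_character_apply, ← map_sum]
    have h4 : ∑ i, r.1 i • a i = 0 := by
      have h5 : l r.1 = 0 := by
        have : r.1 ∈ LinearMap.ker l := hs ▸ Submodule.subset_span r.2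
        exact this
      apply Subtype.ext
      have h6 := congrArg (fun x : I => MulOpposite.op x.1) h5
      simpa [l, Fintype.linearCombination_apply, b', b] using h6
    rw [h4, map_zero]
    rfl
  let f : TensorProduct ℤ J (CharacterModule E) →+ CharacterModule E :=
    TensorProduct.liftAddHom (AddMonoidHom.mk'
      (fun x => DistribSMul.toAddMonoidHom (CharacterModule E) x.1.unop)
      fun x y => by ext1 φ; exact add_smul x.1.unop y.1.unop φ)
      fun r x φ => by
        change (r • x.1.unop) • φ = x.1.unop • (r • φ)
        rw [smul_assoc, smul_comm]
  let g : TensorProduct ℤ J (CharacterModule E) →+ AddCircle (1 : ℚ) :=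
    TensorProduct.liftAddHom (AddMonoidHom.mk'
      (fun x => (h x : CharacterModule E →+ AddCircle (1 : ℚ))) fun x y => map_add h x y)
      fun r x φ => by
        change h (r • x) φ = h x (r • φ)
        rw [map_zsmul h, map_zsmul (h x)]; rfl
  obtain ⟨κ, hκ⟩ := exists_character_comp_eq f g (by
    intro t ht
    obtain ⟨s, rfl⟩ := TensorProduct.exists_finset t
    rw [map_sum, ← Finset.sum_coe_sort] at ht ⊢
    exact key s (fun i => i.1.1) (fun i => i.1.2) ht)
  refine ⟨LinearMap.toSpanSingleton Rᵐᵒᵖ (CharacterModule (CharacterModule E)) κ,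
    fun x hx => character_ext fun φ => ?_⟩
  exact hκ (TensorProduct.tmul ℤ ⟨x, hx⟩ φ)

/-! ### The pure embedding into the bidual -/

section Bidual

variable (R) (Q : Type u) [AddCommGroup Q] [Module R Q]

/-- The canonical map `Q → Q⁺⁺`. -/
def toBidual : Q →ₗ[R] CharacterModule (CharacterModule Q) := flipLeft R LinearMap.id

theorem toBidual_injective : Function.Injective (toBidual R Q) := by
  rw [injective_iff_map_eq_zero]
  intro q hq
  exact CharacterModule.eq_zero_of_character_apply fun c => DFunLike.congr_fun hq c

/-- The canonical map `Q⁺ → Q⁺⁺⁺` splits the dual of `Q → Q⁺⁺`, so `(Q⁺⁺/Q)⁺` is a retract of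
`Q⁺⁺⁺`. The latter is injective, since `Q⁺⁺` is flat by coherence. -/
theorem isFlat_bidual_quotient (hcoh : IsRightCoherent R) (hQ : IsFlat R Q) :
    IsFlat R (CharacterModule (CharacterModule Q) ⧸ LinearMap.range (toBidual R Q)) := by
  have hp := (LinearMap.range (toBidual R Q)).mkQ_surjective
  have hex : Function.Exact (toBidual R Q) (LinearMap.range (toBidual R Q)).mkQ :=
    LinearMap.exact_map_mkQ_range _
  obtain ⟨r, hr⟩ := exists_retraction_of_section (dualMap_injective hp) (dualMap_exact hex)
    (flipRight R LinearMap.id) fun _ => rfl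
  exact isFlat_iff_injective.2 (injective_of_retract _ r hr (isFlat_iff_injective.1
    (hcoh.isFlat_characterModule _ (isFlat_iff_injective.1 hQ))))

end Bidual

/-! ### Free covers and vanishing of Ext -/

section FreeCover

variable (X : Type u) [AddCommGroup X] [Module R X]

variable (R) in
/-- The canonical map from the free module on the elements of `X` to `X`. -/
def freeCover : (X →₀ R) →ₗ[R] X := Finsupp.linearCombination R id

theorem freeCover_surjective : Function.Surjective (freeCover R X) :=
  Finsupp.linearCombination_id_surjective R X

end FreeCover

-- In degree one this is `IsFlat.exists_extension`; higher degrees shift to the kernel of the free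
-- cover, which is again flat.
open Abelian in
theorem IsFlat.ext_eq_zero {E : Type u} [AddCommGroup E] [Module Rᵐᵒᵖ E] (n : ℕ) :
    ∀ {C : ModuleCat.{u} R}, IsFlat R C →
      ∀ x : Ext C (ModuleCat.of R (CharacterModule E)) (n + 1), x = 0 := by
  induction n with
  | zero =>
    intro C hC x
    have hS := LinearMap.shortExact_shortComplexKer (freeCover_surjective (R := R) C)
    have : Projective (freeCover R C).shortComplexKer.X₂ :=
      (IsProjective.iff_projective (R := R) (C →₀ R)).1 inferInstance
    obtain ⟨x₁, rfl⟩ := Ext.contravariant_sequence_exact₃ hS _ x (Ext.eq_zero_of_projective _)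
      (add_comm 1 0)
    obtain ⟨g, rfl⟩ := (Ext.mk₀_bijective _ _).2 x₁
    obtain ⟨k, hk⟩ := hC.exists_extension (LinearMap.ker (freeCover R C)).injective_subtype
      (freeCover_surjective (R := R) C) (LinearMap.exact_subtype_ker_map _) g.hom
    have hg : g = (freeCover R C).shortComplexKer.f ≫ ModuleCat.ofHom k :=
      ModuleCat.hom_ext (LinearMap.ext fun x => (hk x).symm)
    rw [hg, ← Ext.mk₀_comp_mk₀, hS.extClass_comp_assoc]
  | succ n ih =>
    intro C hC x
    have hS := LinearMap.shortExact_shortComplexKer (freeCover_surjective (R := R) C)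
    have : Projective (freeCover R C).shortComplexKer.X₂ :=
      (IsProjective.iff_projective (R := R) (C →₀ R)).1 inferInstance
    obtain ⟨x₁, rfl⟩ := Ext.contravariant_sequence_exact₃ hS _ x (Ext.eq_zero_of_projective _)
      (add_comm 1 (n + 1))
    have hK : IsFlat R (LinearMap.ker (freeCover R C)) :=
      IsFlat.of_exact isFlat_of_projective hC (LinearMap.ker (freeCover R C)).injective_subtype
        (freeCover_surjective (R := R) C) (LinearMap.exact_subtype_ker_map _)
    rw [ih (C := ModuleCat.of R (LinearMap.ker (freeCover R C))) hK x₁, Ext.comp_zero]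

open Abelian in
theorem exists_section_of_ext_eq_zero {S : ShortComplex (ModuleCat.{u} R)} (hS : S.ShortExact)
    (h : ∀ x : Ext S.X₃ S.X₁ 1, x = 0) : ∃ s : S.X₃ ⟶ S.X₂, s ≫ S.g = 𝟙 S.X₃ := by
  obtain ⟨s, hs⟩ := Ext.covariant_sequence_exact₃ _ hS (Ext.mk₀ (𝟙 S.X₃)) (zero_add 1) (h _)
  obtain ⟨s, rfl⟩ := (Ext.mk₀_bijective _ _).2 s
  rw [Ext.mk₀_comp_mk₀] at hs
  exact ⟨s, (Ext.mk₀_bijective _ _).1 hs⟩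

open Abelian in
theorem ext_eq_zero_of_succ {S : ShortComplex (ModuleCat.{u} R)} (hS : S.ShortExact)
    {F : ModuleCat.{u} R} {m : ℕ} (h₂ : ∀ x : Ext F S.X₂ m, x = 0)
    (h₁ : ∀ x : Ext F S.X₁ (m + 1), x = 0) (x : Ext F S.X₃ m) : x = 0 := by
  obtain ⟨y, rfl⟩ := Ext.covariant_sequence_exact₃ _ hS x rfl (h₁ _)
  rw [h₂ y, Ext.zero_comp]

/-! ### Exact complexes and exactness of Hom -/

variable (R) in
/-- An exact complex of left modules, indexed by the integers. -/
structure AcyclicComplex where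
  /-- The terms of the complex. -/
  X : ℤ → ModuleCat.{u} R
  /-- The differentials of the complex. -/
  d : ∀ i, X (i + 1) →ₗ[R] X i
  exact : ∀ i, Function.Exact (d (i + 1)) (d i)

namespace AcyclicComplex

variable (C : AcyclicComplex R)

/-- The complex `Hom(C, W)` is exact. -/
def HomExact (W : Type u) [AddCommGroup W] [Module R W] : Prop :=
  ∀ i (g : C.X (i + 1) →ₗ[R] W), g ∘ₗ C.d (i + 1) = 0 → ∃ h : C.X i →ₗ[R] W, h ∘ₗ C.d i = g

variable {C}

theorem HomExact.of_retract {V W : Type u} [AddCommGroup V] [Module R V] [AddCommGroup W]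
    [Module R W] (hV : C.HomExact V) (i : W →ₗ[R] V) (r : V →ₗ[R] W) (h : ∀ x, r (i x) = x) :
    C.HomExact W := by
  intro k g hg
  obtain ⟨f, hf⟩ := hV k (i ∘ₗ g) (by rw [LinearMap.comp_assoc, hg, LinearMap.comp_zero])
  refine ⟨r ∘ₗ f, LinearMap.ext fun x => ?_⟩
  have := LinearMap.congr_fun hf x
  simp only [LinearMap.comp_apply] at this ⊢
  rw [this, h]

/-- Projectivity of the terms makes `0 → Hom(C, W) → Hom(C, V) → Hom(C, U) → 0` exact, and two exact
complexes force the third. Concretely, a solution `f` in `V` is corrected by `k ∘ d` until it lands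
in `W`. -/
theorem HomExact.of_exact (hC : ∀ i, Module.Projective R (C.X i)) {U V W : Type u}
    [AddCommGroup U] [Module R U] [AddCommGroup V] [Module R V] [AddCommGroup W] [Module R W]
    (hV : C.HomExact V) (hU : C.HomExact U) {j : W →ₗ[R] V} {p : V →ₗ[R] U}
    (hj : Function.Injective j) (hp : Function.Surjective p) (h : Function.Exact j p) :
    C.HomExact W := by
  intro i g hg
  obtain ⟨i, rfl⟩ : ∃ k, i = k + 1 := ⟨i - 1, by ring⟩
  obtain ⟨f, hf⟩ := hV _ (j ∘ₗ g) (by rw [LinearMap.comp_assoc, hg, LinearMap.comp_zero])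
  obtain ⟨f', hf'⟩ := hU i (p ∘ₗ f) (by
    rw [LinearMap.comp_assoc, hf, ← LinearMap.comp_assoc, h.linearMap_comp_eq_zero,
      LinearMap.zero_comp])
  have := hC i
  obtain ⟨k, hk⟩ := Module.projective_lifting_property p f' hp
  have hpk : p ∘ₗ (f - k ∘ₗ C.d i) = 0 := by
    rw [LinearMap.comp_sub, ← LinearMap.comp_assoc, hk, hf', sub_self]
  have hl : ∀ x, (f - k ∘ₗ C.d i) x ∈ LinearMap.range j := fun x =>
    (h _).1 (LinearMap.congr_fun hpk x)
  refine ⟨(LinearEquiv.ofInjective j hj).symm.toLinearMap ∘ₗ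
    LinearMap.codRestrict (LinearMap.range j) _ hl, LinearMap.ext fun x => ?_⟩
  simp only [LinearMap.comp_apply, LinearEquiv.coe_coe]
  rw [LinearEquiv.symm_apply_eq]
  apply Subtype.ext
  have h1 := LinearMap.congr_fun hf x
  simp only [LinearMap.comp_apply] at h1
  simp [h1, (C.exact i).apply_apply_eq_zero]

-- Induction along `0 → Q → Q⁺⁺ → Q⁺⁺/Q → 0`. For `m = 0` the sequence splits, as `Q⁺⁺/Q` is flat;
-- otherwise the Ext hypothesis passes to `Q⁺⁺/Q` one degree lower, because Ext from flat modules
-- into `Q⁺⁺` vanishes.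
open Abelian in
theorem homExact_of_ext_eq_zero (hcoh : IsRightCoherent R)
    (hC : ∀ i, Module.Projective R (C.X i))
    (hinj : ∀ (E : Type u) [AddCommGroup E] [Module Rᵐᵒᵖ E], Module.Injective Rᵐᵒᵖ E →
      C.HomExact (CharacterModule E)) (m : ℕ) :
    ∀ (Q : Type u) [AddCommGroup Q] [Module R Q], IsFlat R Q →
      (∀ F : ModuleCat.{u} R, IsFlat R F → ∀ x : Ext F (ModuleCat.of R Q) (m + 1), x = 0) →
      C.HomExact Q := by
  induction m with
  | zero =>
    intro Q _ _ hQ hext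
    let p := (LinearMap.range (toBidual R Q)).mkQ
    have hex : Function.Exact (toBidual R Q) p := LinearMap.exact_map_mkQ_range _
    let S := ModuleCat.shortComplexOfCompEqZero (toBidual R Q) p hex.linearMap_comp_eq_zero
    have hS : S.ShortExact := ModuleCat.shortComplex_shortExact S hex (toBidual_injective R Q)
      (Submodule.mkQ_surjective _)
    obtain ⟨s, hs⟩ := exists_section_of_ext_eq_zero hS
      (hext S.X₃ (isFlat_bidual_quotient R Q hcoh hQ))
    obtain ⟨r, hr⟩ := exists_retraction_of_section (toBidual_injective R Q) hex s.hom
      fun z => ConcreteCategory.congr_hom hs z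
    exact (hinj _ (isFlat_iff_injective.1 hQ)).of_retract _ r hr
  | succ m ih =>
    intro Q _ _ hQ hext
    let p := (LinearMap.range (toBidual R Q)).mkQ
    have hex : Function.Exact (toBidual R Q) p := LinearMap.exact_map_mkQ_range _
    let S := ModuleCat.shortComplexOfCompEqZero (toBidual R Q) p hex.linearMap_comp_eq_zero
    have hS : S.ShortExact := ModuleCat.shortComplex_shortExact S hex (toBidual_injective R Q)
      (Submodule.mkQ_surjective _)
    refine (hinj _ (isFlat_iff_injective.1 hQ)).of_exact hC
      (ih _ (isFlat_bidual_quotient R Q hcoh hQ) fun F hF =>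
        ext_eq_zero_of_succ hS (hF.ext_eq_zero m) (hext F hF))
      (toBidual_injective R Q) (Submodule.mkQ_surjective _) hex

/-- An exact complex of projective modules over a right coherent and left `n`-perfect ring that is
`Hom(-, E⁺)` exact for all injective right modules `E` is `Hom(-, Q)` exact for all flat `Q`. -/
theorem homExact_of_isFlat (hcoh : IsRightCoherent R) {n : ℕ} (hperf : IsLeftPerfect R n)
    (hC : ∀ i, Module.Projective R (C.X i))
    (hinj : ∀ (E : Type u) [AddCommGroup E] [Module Rᵐᵒᵖ E], Module.Injective Rᵐᵒᵖ E →
      C.HomExact (CharacterModule E)) (Q : Type u) [AddCommGroup Q] [Module R Q]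
    (hQ : IsFlat R Q) : C.HomExact Q :=
  homExact_of_ext_eq_zero hcoh hC hinj n Q hQ fun F hF x =>
    have := hperf F hF
    x.eq_zero_of_hasProjectiveDimensionLT (n + 1) le_rfl

/-! ### Passage to and from chain complexes -/

section ChainComplex

variable (C) in
/-- An exact complex as a chain complex. -/
def toChainComplex : ChainComplex (ModuleCat.{u} R) ℤ :=
  ChainComplex.of C.X (fun i => ModuleCat.ofHom (C.d i)) fun i =>
    ModuleCat.hom_ext (C.exact i).linearMap_comp_eq_zero

theorem toChainComplex_d (i : ℤ) : C.toChainComplex.d (i + 1) i = ModuleCat.ofHom (C.d i) :=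
  ChainComplex.of_d C.X (fun i => ModuleCat.ofHom (C.d i)) i

theorem acyclic_toChainComplex : C.toChainComplex.Acyclic := by
  intro i
  obtain ⟨i, rfl⟩ : ∃ k, i = k + 1 := ⟨i - 1, by ring⟩
  rw [HomologicalComplex.exactAt_iff' _ (i + 1 + 1) (i + 1) i (by simp) (by simp),
    ShortComplex.ShortExact.moduleCat_exact_iff_function_exact]
  change Function.Exact (C.toChainComplex.d (i + 1 + 1) (i + 1)) (C.toChainComplex.d (i + 1) i)
  rw [toChainComplex_d, toChainComplex_d]
  exact C.exact i

theorem isHomProjExact_toChainComplex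
    (h : ∀ (Q : Type u) [AddCommGroup Q] [Module R Q], Module.Projective R Q → C.HomExact Q) :
    IsHomProjExact C.toChainComplex := by
  intro Q hQ i
  obtain ⟨j, hj⟩ : ∃ j, j = i - 1 := ⟨_, rfl⟩
  rw [← hj]
  obtain rfl : i = j + 1 := by omega
  intro g
  rw [toChainComplex_d, toChainComplex_d]
  constructor
  · intro hg
    obtain ⟨f, hf⟩ := h Q hQ j g.hom (congrArg ModuleCat.Hom.hom hg)
    exact ⟨ModuleCat.ofHom f, ModuleCat.hom_ext hf⟩
  · rintro ⟨f, rfl⟩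
    refine ModuleCat.hom_ext (LinearMap.ext fun x => ?_)
    exact (congrArg f.hom ((C.exact j).apply_apply_eq_zero x)).trans (map_zero f.hom)

theorem nonempty_equiv_ker_toChainComplex_d {M : Type u} [AddCommGroup M] [Module R M] {i j : ℤ}
    (hij : i = j + 1) (e : M ≃ₗ[R] LinearMap.ker (C.d j)) :
    Nonempty (M ≃ₗ[R] LinearMap.ker (C.toChainComplex.d i j).hom) := by
  subst hij
  rw [toChainComplex_d]
  exact ⟨e⟩

theorem isGorensteinProjective (hC : ∀ i, Module.Projective R (C.X i))
    (h : ∀ (Q : Type u) [AddCommGroup Q] [Module R Q], Module.Projective R Q → C.HomExact Q)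
    {M : ModuleCat.{u} R} (e : M ≃ₗ[R] LinearMap.ker (C.d (-1))) : IsGorensteinProjective M :=
  ⟨C.toChainComplex, hC, acyclic_toChainComplex, isHomProjExact_toChainComplex h,
    nonempty_equiv_ker_toChainComplex_d (by norm_num) e⟩

variable (F : ChainComplex (ModuleCat.{u} R) ℤ)

/-- The exact complex that underlies an acyclic chain complex. -/
def ofChainComplex (hF : F.Acyclic) : AcyclicComplex R where
  X := F.X
  d i := (F.d (i + 1) i).hom
  exact i := by
    have := hF (i + 1)
    rwa [HomologicalComplex.exactAt_iff' _ (i + 1 + 1) (i + 1) i (by simp) (by simp),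
      ShortComplex.ShortExact.moduleCat_exact_iff_function_exact] at this

/-- A cocycle in `Hom(F, E⁺)` is a character of `E ⊗ F` that vanishes on boundaries, hence on
cycles, so it factors through the differential. -/
theorem homExact_ofChainComplex (hF : F.Acyclic) (h : IsInjTensorExact F) (E : Type u)
    [AddCommGroup E] [Module Rᵐᵒᵖ E] (hE : Module.Injective Rᵐᵒᵖ E) :
    (ofChainComplex F hF).HomExact (CharacterModule E) := by
  intro i g hg
  have hex := h E hE (i + 1)
  obtain ⟨j, hj⟩ : ∃ j, j = i + 1 - 1 := ⟨_, rfl⟩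
  rw [← hj] at hex
  obtain rfl : j = i := by omega
  obtain ⟨k, hk⟩ := exists_character_comp_eq
    (balancedMap R (LinearMap.id : E →ₗ[Rᵐᵒᵖ] E) (F.d (j + 1) j).hom).toAddMonoidHom
    (tensorCharacter (flipRight R g)).toAddMonoidHom (by
      intro t ht
      obtain ⟨s, rfl⟩ := (hex t).1 ht
      refine balancedTensor_hom_ext
        (f := ((tensorCharacter (flipRight R g)).comp
          (balancedMap R LinearMap.id (F.d (j + 1 + 1) (j + 1)).hom)).toAddMonoidHom)
        (g := 0) (fun x m => ?_) s
      exact DFunLike.congr_fun (LinearMap.congr_fun hg m) x)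
  refine ⟨flipLeft R (homOfTensorCharacter k), LinearMap.ext fun m => character_ext fun x => ?_⟩
  exact hk (Submodule.Quotient.mk (TensorProduct.tmul ℤ x m))

end ChainComplex

/-- The contractible complex with constant term `P × P` and differential `(x, y) ↦ (y, 0)` has
cycles `P` everywhere. -/
theorem isGorensteinProjective_of_projective {P : ModuleCat.{u} R} [Module.Projective R P] :
    IsGorensteinProjective P := by
  let C : AcyclicComplex R :=
    { X := fun _ => ModuleCat.of R (P × P)
      d := fun _ => LinearMap.inl R P P ∘ₗ LinearMap.snd R P P
      exact := fun _ => by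
        rintro ⟨x, y⟩
        constructor
        · intro h
          obtain rfl : y = 0 := congrArg Prod.fst h
          exact ⟨(0, x), rfl⟩
        · rintro ⟨⟨a, b⟩, h⟩
          obtain rfl : 0 = y := congrArg Prod.snd h
          rfl }
  have hC : ∀ i, Module.Projective R (C.X i) := fun _ =>
    inferInstanceAs (Module.Projective R (P × P))
  refine C.isGorensteinProjective hC (fun Q _ _ _ i g hg => ?_)
    (LinearEquiv.ofBijective (LinearMap.codRestrict (LinearMap.ker (C.d (-1)))
      (LinearMap.inl R P P) fun _ => rfl) ⟨fun x y h => ?_, ?_⟩)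
  · refine ⟨(g : P × P →ₗ[R] Q) ∘ₗ LinearMap.inr R P P ∘ₗ LinearMap.fst R P P,
      LinearMap.ext ?_⟩
    rintro ⟨x, y⟩
    have h0 : g (x, 0) = 0 := LinearMap.congr_fun hg (0, x)
    change g (0, y) = g (x, y)
    rw [← zero_add (g (0, y)), ← h0]
    refine (map_add g (x, 0) (0, y)).symm.trans ?_
    simp
  · exact congrArg (fun z => z.1.1) h
  · rintro ⟨⟨x, y⟩, h⟩
    obtain rfl : y = 0 := congrArg Prod.fst h
    exact ⟨x, rfl⟩

/-! ### The syzygy complex -/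

section Syzygy

variable (C)

/-- The component `Lᵢ × Lᵢ₊₁ → Xᵢ` of a surjection from a contractible complex of free modules to `C`. -/
def cover (i : ℤ) : (C.X i →₀ R) × (C.X (i + 1) →₀ R) →ₗ[R] C.X i :=
  LinearMap.coprod (freeCover R (C.X i)) (C.d i ∘ₗ freeCover R (C.X (i + 1)))

theorem cover_apply (i : ℤ) (x : C.X i →₀ R) (y : C.X (i + 1) →₀ R) :
    C.cover i (x, y) = freeCover R (C.X i) x + C.d i (freeCover R (C.X (i + 1)) y) := rfl

theorem cover_surjective (i : ℤ) : Function.Surjective (C.cover i) := fun z => by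
  obtain ⟨x, rfl⟩ := freeCover_surjective (R := R) (C.X i) z
  exact ⟨(x, 0), by simp [cover_apply]⟩

/-- The differential of the contractible complex of free modules that covers `C`. -/
def coverD (i : ℤ) : (C.X (i + 1) →₀ R) × (C.X (i + 1 + 1) →₀ R) →ₗ[R]
    (C.X i →₀ R) × (C.X (i + 1) →₀ R) :=
  LinearMap.inr R _ _ ∘ₗ LinearMap.fst R _ _

theorem coverD_apply (i : ℤ) (x : C.X (i + 1) →₀ R) (y : C.X (i + 1 + 1) →₀ R) :
    C.coverD i (x, y) = (0, x) := rfl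

theorem cover_coverD (i : ℤ) (x : (C.X (i + 1) →₀ R) × (C.X (i + 1 + 1) →₀ R)) :
    C.cover i (C.coverD i x) = C.d i (C.cover (i + 1) x) := by
  obtain ⟨x, y⟩ := x
  rw [coverD_apply, cover_apply, cover_apply, map_add, (C.exact i).apply_apply_eq_zero]
  simp

/-- The syzygy complex of `C`: the kernel of the surjection from a contractible complex of free
modules to `C`. -/
def syzygy : AcyclicComplex R where
  X i := ModuleCat.of R (LinearMap.ker (C.cover i))
  d i := (C.coverD i).restrict fun x hx => by
    rw [LinearMap.mem_ker] at hx ⊢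
    rw [cover_coverD, hx, map_zero]
  exact i := by
    rintro ⟨⟨x, y⟩, hx⟩
    constructor
    · intro h
      obtain rfl : x = 0 := congrArg (fun z => z.1.2) h
      rw [LinearMap.mem_ker, cover_apply, map_zero, zero_add] at hx
      obtain ⟨z, hz⟩ := (C.exact (i + 1) _).1 hx
      obtain ⟨w, rfl⟩ := freeCover_surjective (R := R) _ z
      -- The sign makes the two summands of `cover` cancel.
      refine ⟨⟨(y, -w), ?_⟩, rfl⟩
      rw [LinearMap.mem_ker, cover_apply, map_neg, map_neg, hz, add_neg_cancel]
    · rintro ⟨⟨⟨a, b⟩, h'⟩, h⟩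
      obtain rfl : 0 = x := congrArg (fun z => z.1.1) h
      rfl

variable {C}

theorem isFlat_syzygy (hC : ∀ i, IsFlat R (C.X i)) (i : ℤ) : IsFlat R (C.syzygy.X i) :=
  IsFlat.of_exact (P := (C.X i →₀ R) × (C.X (i + 1) →₀ R)) isFlat_of_projective (hC i)
    (LinearMap.ker (C.cover i)).injective_subtype
    (C.cover_surjective i) (LinearMap.exact_subtype_ker_map _)

theorem hasProjectiveDimensionLE_syzygy {m : ℕ} (i : ℤ)
    (hC : HasProjectiveDimensionLE (C.X i) (m + 1)) :
    HasProjectiveDimensionLE (C.syzygy.X i) m := by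
  have hS := LinearMap.shortExact_shortComplexKer (C.cover_surjective i)
  have : Projective (C.cover i).shortComplexKer.X₂ :=
    (IsProjective.iff_projective (R := R) ((C.X i →₀ R) × (C.X (i + 1) →₀ R))).1 inferInstance
  exact (hS.hasProjectiveDimensionLT_X₃_iff m this).1 hC

/-- Flatness of the terms extends a cocycle `g` to a map `f` on the contractible cover. Then `f ∘
coverD` descends to a cocycle `a` on `C`, so `a = b ∘ d`. The map `f - b ∘ cover` still restricts to
`g` and kills the image of `coverD`, hence it factors through `coverD`. -/
theorem HomExact.syzygy (hC : ∀ i, IsFlat R (C.X i)) {E : Type u} [AddCommGroup E]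
    [Module Rᵐᵒᵖ E] (h : C.HomExact (CharacterModule E)) :
    C.syzygy.HomExact (CharacterModule E) := by
  intro i g hg
  obtain ⟨f, hf⟩ := (hC (i + 1)).exists_extension
    (LinearMap.ker (C.cover (i + 1))).injective_subtype
    (C.cover_surjective (i + 1)) (LinearMap.exact_subtype_ker_map _) g
  obtain ⟨a, ha⟩ := exists_comp_eq_of_surjective (C.cover_surjective (i + 1 + 1))
    (f ∘ₗ C.coverD (i + 1)) (fun x hx => by
      exact (hf (C.syzygy.d (i + 1) ⟨x, hx⟩)).trans (LinearMap.congr_fun hg ⟨x, hx⟩))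
  obtain ⟨b, hb⟩ := h (i + 1) a (LinearMap.ext fun x => by
    obtain ⟨x, rfl⟩ := C.cover_surjective _ x
    rw [LinearMap.comp_apply, ← cover_coverD, ha]
    obtain ⟨x, y⟩ := x
    simp only [LinearMap.comp_apply, coverD_apply, LinearMap.zero_apply]
    exact map_zero f)
  have key : ∀ x, f (0, x) = b (C.cover (i + 1) (0, x)) := fun x => by
    have h1 := ha (x, 0)
    rw [← hb, LinearMap.comp_apply, ← cover_coverD] at h1
    exact h1.symm
  let c : (C.X i →₀ R) × (C.X (i + 1) →₀ R) →ₗ[R] CharacterModule E :=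
    (f - b ∘ₗ C.cover (i + 1)) ∘ₗ LinearMap.inl R _ _ ∘ₗ LinearMap.snd R _ _
  refine ⟨c ∘ₗ (LinearMap.ker (C.cover i)).subtype, LinearMap.ext ?_⟩
  rintro ⟨⟨x, y⟩, hx⟩
  refine Eq.trans ?_ (hf ⟨(x, y), hx⟩)
  change f (x, 0) - b (C.cover (i + 1) (x, 0)) = f (x, y)
  have hxy : (x, y) = (x, 0) + (0, y) := by simp
  rw [LinearMap.mem_ker, hxy, map_add, add_eq_zero_iff_eq_neg] at hx
  rw [hxy, map_add, key, hx, map_neg, sub_neg_eq_add]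

end Syzygy

/-! ### Assembling the Gorenstein projective resolution -/

theorem hasGorensteinProjectiveDimensionLE_succ {Z G M : ModuleCat.{u} R} {m : ℕ}
    (hZ : HasGorensteinProjectiveDimensionLE Z m) (hG : IsGorensteinProjective G)
    (j : Z →ₗ[R] G) (p : G →ₗ[R] M) (hj : Function.Injective j) (hp : Function.Surjective p)
    (h : Function.Exact j p) : HasGorensteinProjectiveDimensionLE M (m + 1) := by
  obtain ⟨H, d, ε, hH, h0, hε, hdε, hd⟩ := hZ
  let H' : ℕ → ModuleCat.{u} R := fun i => Nat.casesOn i G H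
  let d' : ∀ i, H' (i + 1) ⟶ H' i := fun i =>
    match i with
    | 0 => ε ≫ ModuleCat.ofHom j
    | i + 1 => d i
  refine ⟨H', d', ModuleCat.ofHom p, ?_, ?_, hp, ?_, ?_⟩
  · rintro (_ | i)
    exacts [hG, hH i]
  · rintro (_ | i) hi
    exacts [absurd hi (by omega), h0 i (by omega)]
  · intro x
    refine (h x).trans ⟨?_, ?_⟩
    · rintro ⟨z, rfl⟩
      obtain ⟨y, rfl⟩ := hε z
      exact ⟨y, rfl⟩
    · rintro ⟨y, rfl⟩
      exact ⟨ε y, rfl⟩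
  · rintro (_ | i)
    · intro x
      refine Iff.trans ?_ (hdε x)
      exact map_eq_zero_iff j hj
    · exact hd i

theorem exists_family_of_zero_maps (G : ℕ → ModuleCat.{u} R) :
    ∃ d : ∀ i, G (i + 1) ⟶ G i, ∀ i x, d i x = 0 :=
  ⟨fun _ => 0, fun _ _ => rfl⟩

/-- The induction lowers only `m`, the bound for the terms of `C`; the perfectness bound `n` stays
fixed, as it enters only through exactness of Hom when the terms have become projective. -/
theorem hasGorensteinProjectiveDimensionLE (hcoh : IsRightCoherent R) {n : ℕ}
    (hperf : IsLeftPerfect R n) (m : ℕ) : ∀ (C : AcyclicComplex R), (∀ i, IsFlat R (C.X i)) →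
      (∀ (E : Type u) [AddCommGroup E] [Module Rᵐᵒᵖ E], Module.Injective Rᵐᵒᵖ E →
        C.HomExact (CharacterModule E)) →
      (∀ i, HasProjectiveDimensionLE (C.X i) m) →
      ∀ M : ModuleCat.{u} R, (M ≃ₗ[R] LinearMap.ker (C.d (-1))) →
        HasGorensteinProjectiveDimensionLE M m := by
  induction m with
  | zero =>
    intro C _ hinj hpd M e
    have hC : ∀ i, Module.Projective R (C.X i) := fun i =>
      (IsProjective.iff_projective (R := R) (C.X i)).2
        ((projective_iff_hasProjectiveDimensionLE_zero _).2 (hpd i))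
    have hM : IsGorensteinProjective M := C.isGorensteinProjective hC
      (fun Q _ _ _ => homExact_of_isFlat hcoh hperf hC hinj Q isFlat_of_projective) e
    have : Module.Projective R (ModuleCat.of R PUnit.{u + 1}) :=
      inferInstanceAs (Module.Projective R PUnit.{u + 1})
    let G : ℕ → ModuleCat.{u} R := fun i => Nat.casesOn i M fun _ => ModuleCat.of R PUnit.{u + 1}
    obtain ⟨d, hd⟩ := exists_family_of_zero_maps G
    refine ⟨G, d, 𝟙 M, ?_, ?_, fun x => ⟨x, rfl⟩, ?_, ?_⟩
    · rintro (_ | i)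
      exacts [hM, isGorensteinProjective_of_projective]
    · rintro (_ | i) hi
      exacts [absurd hi (by omega), inferInstanceAs (Subsingleton PUnit.{u + 1})]
    · intro x
      exact ⟨fun h => ⟨0, (hd 0 0).trans h.symm⟩, fun ⟨y, h⟩ => h.symm.trans (hd 0 y)⟩
    · intro i x
      exact ⟨fun _ => ⟨0, (Subsingleton.elim (α := PUnit.{u + 1}) _ _)⟩, fun _ => hd i x⟩
  | succ m ih =>
    intro C hC hinj hpd M e
    have hker := ih C.syzygy (isFlat_syzygy hC) (fun E _ _ hE => (hinj E hE).syzygy hC)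
      (fun i => hasProjectiveDimensionLE_syzygy i (hpd i))
      (ModuleCat.of R (LinearMap.ker (C.syzygy.d (-1)))) (LinearEquiv.refl R _)
    -- The degree-0 cycles of the contractible cover are the pairs `(0, y)`, so they form the free
    -- module on degree 1. They map onto the cycles of `C`, with the cycles of the syzygy complex as
    -- kernel.
    let L := C.X (-1 + 1 + 1) →₀ R
    have : Module.Projective R (ModuleCat.of R L) := inferInstanceAs (Module.Projective R L)
    let q : L →ₗ[R] LinearMap.ker (C.d (-1)) :=
      LinearMap.codRestrict _ (C.d (-1 + 1) ∘ₗ freeCover R _) fun x =>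
        (C.exact (-1)).apply_apply_eq_zero _
    let j : LinearMap.ker (C.syzygy.d (-1)) →ₗ[R] L :=
      LinearMap.snd R _ _ ∘ₗ (LinearMap.ker (C.cover (-1 + 1))).subtype ∘ₗ
        (LinearMap.ker (C.syzygy.d (-1))).subtype
    have hzero : ∀ z : LinearMap.ker (C.syzygy.d (-1)), z.1.1.1 = 0 := fun z =>
      congrArg (fun w => w.1.2) z.2
    refine hasGorensteinProjectiveDimensionLE_succ hker
      (isGorensteinProjective_of_projective (P := ModuleCat.of R L)) j
      (e.symm.toLinearMap ∘ₗ q) ?_ ?_ ?_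
    · intro z w h
      exact Subtype.ext (Subtype.ext (Prod.ext ((hzero z).trans (hzero w).symm) h))
    · refine e.symm.surjective.comp ?_
      rintro ⟨z, hz⟩
      obtain ⟨w, rfl⟩ := (C.exact (-1) z).1 hz
      obtain ⟨y, rfl⟩ := freeCover_surjective (R := R) _ w
      exact ⟨y, rfl⟩
    · intro y
      have hy : (e.symm.toLinearMap ∘ₗ q) y = 0 ↔ C.cover (-1 + 1) (0, y) = 0 := by
        rw [LinearMap.comp_apply, LinearEquiv.coe_coe, LinearEquiv.map_eq_zero_iff, cover_apply,
          map_zero, zero_add]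
        exact Subtype.ext_iff
      refine hy.trans ⟨fun h => ⟨⟨⟨(0, y), h⟩, rfl⟩, rfl⟩, ?_⟩
      rintro ⟨z, rfl⟩
      have h1 : (0, j z) = z.1.1 := Prod.ext (hzero z).symm rfl
      rw [h1]
      exact z.1.2

end AcyclicComplex

end

end GorensteinModules

theorem proposition5 (R : Type u) [Ring R] (n : ℕ)
    (hcoh : GorensteinModules.IsRightCoherent R)
    (hperf : GorensteinModules.IsLeftPerfect R n)
    (M : ModuleCat.{u} R) (hM : GorensteinModules.IsGorensteinFlat M) :
    GorensteinModules.HasGorensteinProjectiveDimensionLE M n := by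
  obtain ⟨F, hF, hac, hten, ⟨e⟩⟩ := hM
  exact GorensteinModules.AcyclicComplex.hasGorensteinProjectiveDimensionLE hcoh hperf n
    (GorensteinModules.AcyclicComplex.ofChainComplex F hac) hF
    (fun E _ _ hE => GorensteinModules.AcyclicComplex.homExact_ofChainComplex F hac hten E hE)
    (fun i => hperf _ (hF i)) M e
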